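/- Rings are commutative with unit. For a morphism of schemes $f : X \to S$, let $\mathrm{Rel}(f)\subseteq S$ (resp. $\mathrm{QRel}(f)\subseteq S$) be the set of points $f(x)$, where $x \in X$ is such that the residue field extension $\kappa(f(x)) \subseteq \kappa(x)$ is trivial (resp. purely inseparable). A scheme $S$ is a Poonen scheme if for every nonempty open $U \subseteq S$ and every dominant morphism of finite presentation $f : X \to U$ one has $\mathrm{QRel}(f) \neq \emptyset$; a ring $A$ is a Poonen ring if $\mathrm{Spec}(A)$ is a Poonen scheme. For an integral domain $A$, consider the conditions: (P1) for every nonconstant $F \in A[Y]$, the set $\mathrm{Rel}\bigl(\mathrm{Spec}(A[Y]/(F)) \to \mathrm{Spec}(A)\bigr)$ is dense in $\mathrm{Spec}(A)$; (P2) for every nonconstant $F \in A[Y]$, there exists $b \in A$ such that $F(b) \notin A^\times$. Let $A$ be an integral domain, let $g \in A$ be nonzero, and let $A_g$ be the localization of $A$ at the powers of $g$. (1) If $A$ satisfies (P2), then $A$ satisfies (P1); if $A_g$ satisfies (P2), then $A_g$ satisfies (P1); if $A$ satisfies (P1), then $A$ is a Poonen ring; if $A$ satisfies (P2), then $A_g$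 satisfies (P2); and $A$ satisfies (P1) if and only if $A_g$ satisfies (P1). (2) If $A$ is a Jacobson ring, then $A$ satisfies (P2) if and only if it satisfies (P1); $A_g$ satisfies (P2) if and only if it satisfies (P1); and $A$ satisfies (P2) if and only if $A_g$ satisfies (P2). -/

import Mathlib

open AlgebraicGeometry CategoryTheory Polynomial

universe u

/-- The points `x` of `X` whose residue field is a radicial (purely inseparable) extension of the
residue field of `f x`. -/
def QuasiLiftPoints {X S : Scheme.{u}} (f : X ⟶ S) : Set X :=
  {x | letI : Algebra (S.residueField (f x)) (X.residueField x) :=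
        (f.residueFieldMap x).hom.toAlgebra
       IsPurelyInseparable (S.residueField (f x)) (X.residueField x)}

/-- The points `x` of `X` whose residue field is a trivial extension of the residue field
of `f x`. -/
def LiftPoints {X S : Scheme.{u}} (f : X ⟶ S) : Set X :=
  {x | Function.Bijective (f.residueFieldMap x).hom}

/-- The set of points of `S` that are quasi-liftable to `X`. -/
def QuasiLiftableSet {X S : Scheme.{u}} (f : X ⟶ S) : Set S :=
  f '' QuasiLiftPoints f

/-- The set of points of `S` that are liftable to `X`. -/
def LiftableSet {X S : Scheme.{u}} (f : X ⟶ S) : Set S :=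
  f '' LiftPoints f

/-- Morphisms of finite presentation: locally of finite presentation, quasi-compact and
quasi-separated. -/
structure IsOfFinitePresentation {X S : Scheme.{u}} (f : X ⟶ S) : Prop where
  locallyOfFinitePresentation : LocallyOfFinitePresentation f
  quasiCompact : QuasiCompact f
  quasiSeparated : QuasiSeparated f

/-- Poonen schemes. -/
def IsPoonenScheme (S : Scheme.{u}) : Prop :=
  ∀ (U : S.Opens), (U : Set S).Nonempty →
    ∀ (X : Scheme.{u}) (f : X ⟶ U.toScheme),
      IsOfFinitePresentation f → IsDominant f → (QuasiLiftableSet f).Nonempty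

/-- Poonen rings. -/
def IsPoonenRing (A : Type u) [CommRing A] : Prop :=
  IsPoonenScheme (Spec (CommRingCat.of A))

/-- The structure morphism `Spec (A[Y]/(F)) ⟶ Spec A`. -/
noncomputable def polyScheme {A : Type u} [CommRing A] (F : A[X]) :
    Spec (CommRingCat.of (A[X] ⧸ Ideal.span {F})) ⟶ Spec (CommRingCat.of A) :=
  Spec.map (CommRingCat.ofHom (algebraMap A (A[X] ⧸ Ideal.span {F})))

/-- Condition (P1): for every nonconstant `F`, the set of points of `Spec A` liftable to
`Spec (A[Y]/(F))` is dense. -/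
def SatisfiesP1 (A : Type u) [CommRing A] : Prop :=
  ∀ F : A[X], F.natDegree ≠ 0 → Dense (LiftableSet (polyScheme F))

/-- Condition (P2): every nonconstant `F` takes a non-invertible value on `A`. -/
def SatisfiesP2 (A : Type u) [CommRing A] : Prop :=
  ∀ F : A[X], F.natDegree ≠ 0 → ∃ b : A, ¬ IsUnit (F.eval b)

/-! For a domain, (P1) says that every nonconstant `F` has, for each `h ≠ 0`, a root in some residue
field where `h` does not vanish (`satisfiesP1_iff`). In this form invariance under localization is a
matter of clearing denominators.

(P2) passes to `A_g` because, for `F(0) ≠ 0` and `c = F(0) g`, the polynomial `F(cX) / F(0)` lies in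
`A[X]` and is `1` modulo `g`: a maximal ideal containing one of its values avoids `g`. Applying (P2)
in `A_h` then gives (P1). If `A` is Jacobson, a root `a / b` in the residue field of a prime can be
reduced modulo a maximal ideal above that prime that avoids `b`, so (P1) gives (P2).

For (P1) implies Poonen, a dominant morphism of finite type has a point in a finite extension `L` of
`K = Frac A`. Up to `q`-power roots `L` is `K(α)`. Let `F` be the minimal polynomial of `α` with
denominators cleared. A root of `F` in a residue field `k`, away from a bad locus `d = 0`,
specializes the point, and its coordinates land in the perfect closure of `k`
(`exists_spread_perfectClosure`). -/

/-- A ring homomorphism `φ : A → k` to a field exhibits `k` as the residue field of a prime ideal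
of `A` if every element of `k` is a quotient of elements of the image of `φ`. -/
def IsResidueHom {A k : Type*} [CommRing A] [Field k] (φ : A →+* k) : Prop :=
  ∀ z : k, ∃ a b : A, φ b ≠ 0 ∧ z * φ b = φ a

/-- The polynomial `F` has a root in a residue field of `A` in which `h` is nonzero. -/
def HasResidualRoot {A : Type u} [CommRing A] (F : A[X]) (h : A) : Prop :=
  ∃ (k : Type u) (_ : Field k) (φ : A →+* k), IsResidueHom φ ∧ φ h ≠ 0 ∧
    ∃ y : k, F.eval₂ φ y = 0

/-! ### Residue fields of affine schemes and field-valued points -/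

instance spec_asIdeal_isPrime {R : CommRingCat.{u}} (p : Spec R) : p.asIdeal.IsPrime :=
  PrimeSpectrum.isPrime p

/-- The evaluation of elements of a ring `R` in the residue field of a point of `Spec R`. -/
noncomputable def specEvaluation {R : CommRingCat.{u}} (p : Spec R) :
    R →+* (Spec R).residueField p :=
  (CommRingCat.ofHom (algebraMap R p.asIdeal.ResidueField) ≫
    (Scheme.Spec.residueFieldIso R p).inv).hom

theorem SpecMap_specEvaluation {R : CommRingCat.{u}} (p : Spec R) :
    Spec.map (CommRingCat.ofHom (specEvaluation p)) = (Spec R).fromSpecResidueField p :=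
  (Spec.map_comp _ _).trans (Scheme.Spec.map_residueFieldIso_inv_eq_fromSpecResidueField _ p)

theorem residueFieldIso_specEvaluation {R : CommRingCat.{u}} (p : Spec R) (a : R) :
    (Scheme.Spec.residueFieldIso R p).hom.hom (specEvaluation p a) =
      algebraMap R p.asIdeal.ResidueField a :=
  congr($((Scheme.Spec.residueFieldIso R p).inv_hom_id).hom _)

theorem specEvaluation_eq_zero_iff {R : CommRingCat.{u}} (p : Spec R) (a : R) :
    specEvaluation p a = 0 ↔ a ∈ p.asIdeal := by
  refine Iff.trans ?_ (Ideal.algebraMap_residueField_eq_zero (I := p.asIdeal))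
  rw [← residueFieldIso_specEvaluation]
  exact (map_eq_zero_iff _
    (Scheme.Spec.residueFieldIso R p).commRingCatIsoToRingEquiv.injective).symm

theorem residueFieldMap_specEvaluation {A B : Type u} [CommRing A] [CommRing B] (φ : A →+* B)
    (x : Spec (.of B)) (a : A) :
    ((Spec.map (CommRingCat.ofHom φ)).residueFieldMap x).hom (specEvaluation _ a) =
      specEvaluation x (φ a) := by
  have h := Scheme.Hom.SpecMap_residueFieldMap_fromSpecResidueField
    (Spec.map (CommRingCat.ofHom φ)) x
  rw [← SpecMap_specEvaluation, ← SpecMap_specEvaluation, ← Spec.map_comp, ← Spec.map_comp,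
    Spec.map_inj] at h
  exact congr($(h).hom a)

/-- A field-valued point of `X` over `Spec A`, in terms of the residue fields. -/
theorem exists_residueField_embedding {A E : Type u} [CommRing A] [Field E] {X : Scheme.{u}}
    (f : X ⟶ Spec (.of A)) (y : Spec (.of E) ⟶ X) (ψ : A →+* E)
    (h : y ≫ f = Spec.map (CommRingCat.ofHom ψ)) :
    ∃ (x : X) (e : X.residueField x →+* E), ∀ a,
      e ((f.residueFieldMap x).hom (specEvaluation (f x) a)) = ψ a := by
  obtain ⟨⟨x, e⟩, rfl⟩ := (Scheme.SpecToEquivOfField E X).symm.surjective y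
  refine ⟨x, e.hom, fun a ↦ ?_⟩
  rw [Scheme.SpecToEquivOfField_symm_apply, Category.assoc,
    ← Scheme.Hom.SpecMap_residueFieldMap_fromSpecResidueField, ← SpecMap_specEvaluation,
    ← Spec.map_comp, ← Spec.map_comp, Spec.map_inj] at h
  exact congr($(h).hom a)

/-- The residue field at the image of `y` embeds in `E`, and the fractions `ψ a / ψ b` already come
from the residue field below, so the power condition descends from `E`. -/
theorem quasiLiftPoints_nonempty_of_pow_mem {A E : Type u} [CommRing A] [Field E] {X : Scheme.{u}}
    (f : X ⟶ Spec (.of A)) (y : Spec (.of E) ⟶ X) (ψ : A →+* E)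
    (h : y ≫ f = Spec.map (CommRingCat.ofHom ψ)) (q : ℕ) [ExpChar E q]
    (hq : ∀ z : E, ∃ (n : ℕ) (a b : A), ψ b ≠ 0 ∧ z ^ q ^ n * ψ b = ψ a) :
    (QuasiLiftPoints f).Nonempty := by
  obtain ⟨x, e, he⟩ := exists_residueField_embedding f y ψ h
  let ρ := (f.residueFieldMap x).hom
  let : Algebra ((Spec (.of A)).residueField (f x)) (X.residueField x) := ρ.toAlgebra
  have : ExpChar ((Spec (.of A)).residueField (f x)) q :=
    (RingHom.expChar_iff (e.comp ρ) (RingHom.injective _) q).mpr ‹_›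
  refine ⟨x, (isPurelyInseparable_iff_pow_mem _ q).mpr fun z ↦ ?_⟩
  obtain ⟨n, a, b, hb, hz⟩ := hq (e z)
  refine ⟨n, specEvaluation _ a / specEvaluation _ b, ?_⟩
  apply e.injective
  change e (ρ _) = _
  rw [map_div₀, map_div₀, map_pow, he, he, div_eq_iff hb, hz]

theorem exists_mem_liftPoints_of_isResidueHom {A E : Type u} [CommRing A] [Field E] {X : Scheme.{u}}
    (f : X ⟶ Spec (.of A)) (y : Spec (.of E) ⟶ X) (ψ : A →+* E)
    (h : y ≫ f = Spec.map (CommRingCat.ofHom ψ)) (hψ : IsResidueHom ψ) :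
    ∃ x ∈ LiftPoints f, ∀ a ∈ (f x).asIdeal, ψ a = 0 := by
  obtain ⟨x, e, he⟩ := exists_residueField_embedding f y ψ h
  let ρ := (f.residueFieldMap x).hom
  refine ⟨x, ⟨RingHom.injective _, fun z ↦ ?_⟩, fun a ha ↦ ?_⟩
  · obtain ⟨a, b, hb, hz⟩ := hψ (e z)
    refine ⟨specEvaluation _ a / specEvaluation _ b, ?_⟩
    apply e.injective
    change e (ρ _) = _
    rw [map_div₀, map_div₀, he, he, div_eq_iff hb, hz]
  · rw [← he, (specEvaluation_eq_zero_iff _ a).mpr ha, map_zero, map_zero]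

theorem quasiLiftPoints_comp_subset {X Y Z : Scheme.{u}} (f : X ⟶ Y) (j : Y ⟶ Z)
    [IsOpenImmersion j] : QuasiLiftPoints (f ≫ j) ⊆ QuasiLiftPoints f := by
  intro x hx
  let : Algebra (Z.residueField (j (f x))) (Y.residueField (f x)) :=
    (j.residueFieldMap (f x)).hom.toAlgebra
  let : Algebra (Y.residueField (f x)) (X.residueField x) := (f.residueFieldMap x).hom.toAlgebra
  let : Algebra (Z.residueField (j (f x))) (X.residueField x) :=
    ((f ≫ j).residueFieldMap x).hom.toAlgebra
  have : IsScalarTower (Z.residueField (j (f x))) (Y.residueField (f x)) (X.residueField x) :=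
    IsScalarTower.of_algebraMap_eq' congr($(Scheme.residueFieldMap_comp f j x).hom)
  have : IsPurelyInseparable (Z.residueField (j (f x))) (X.residueField x) := hx
  exact IsPurelyInseparable.tower_top (Z.residueField (j (f x))) _ _

/-! ### (P1) in terms of roots in residue fields -/

theorem PrimeSpectrum.dense_iff_of_isDomain {A : Type*} [CommRing A] [IsDomain A]
    (s : Set (PrimeSpectrum A)) : Dense s ↔ ∀ h : A, h ≠ 0 → ∃ p ∈ s, h ∉ p.asIdeal := by
  rw [(PrimeSpectrum.isTopologicalBasis_basic_opens (R := A)).dense_iff]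
  constructor
  · intro H h hh
    obtain ⟨p, hp, hps⟩ := H _ ⟨h, rfl⟩ ⟨⊥, by simpa using hh⟩
    exact ⟨p, hps, hp⟩
  · rintro H _ ⟨h, rfl⟩ ⟨p, hp⟩
    obtain ⟨p, hps, hp⟩ := H h (by rintro rfl; simp at hp)
    exact ⟨p, hp, hps⟩

theorem isResidueHom_algebraMap_residueField {A : Type*} [CommRing A] (p : Ideal A) [p.IsPrime] :
    IsResidueHom (algebraMap A p.ResidueField) := by
  intro z
  obtain ⟨a, b, hb, rfl⟩ := IsFractionRing.div_surjective (A := A ⧸ p) z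
  obtain ⟨a, rfl⟩ := Ideal.Quotient.mk_surjective a
  obtain ⟨b, rfl⟩ := Ideal.Quotient.mk_surjective b
  have hb' : algebraMap A p.ResidueField b ≠ 0 := by
    rw [Ne, Ideal.algebraMap_residueField_eq_zero, ← Ideal.Quotient.eq_zero_iff_mem]
    exact nonZeroDivisors.ne_zero hb
  exact ⟨a, b, hb', by simp [div_mul_cancel₀ _ hb']⟩

theorem satisfiesP1_iff {A : Type u} [CommRing A] [IsDomain A] :
    SatisfiesP1 A ↔ ∀ F : A[X], F.natDegree ≠ 0 → ∀ h : A, h ≠ 0 → HasResidualRoot F h := by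
  refine forall_congr' fun F ↦ imp_congr_right fun _ ↦
    (PrimeSpectrum.dense_iff_of_isDomain (A := A) _).trans ?_
  refine forall_congr' fun h ↦ imp_congr_right fun _ ↦ ?_
  constructor
  · rintro ⟨_, ⟨x, hx, rfl⟩, hxh⟩
    let p : PrimeSpectrum A := polyScheme F x
    let e := RingEquiv.ofBijective _ hx
    let r : (Spec (.of A)).residueField (polyScheme F x) →+* p.asIdeal.ResidueField :=
      (Scheme.Spec.residueFieldIso (.of A) (polyScheme F x)).hom.hom
    -- At a liftable point the residue field map is invertible, so evaluation at `x` takes values in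
    -- the residue field below; the class of the variable gives the root.
    let θ : A[X] ⧸ Ideal.span {F} →+* p.asIdeal.ResidueField :=
      (r.comp e.symm.toRingHom).comp (specEvaluation x)
    have hθ : θ.comp (algebraMap A _) = algebraMap A p.asIdeal.ResidueField := by
      ext a
      refine Eq.trans ?_ (residueFieldIso_specEvaluation (polyScheme F x) a)
      refine congrArg r (e.injective ?_)
      refine (e.apply_symm_apply _).trans ?_
      exact (residueFieldMap_specEvaluation _ x a).symm
    refine ⟨p.asIdeal.ResidueField, inferInstance, algebraMap A _,
      isResidueHom_algebraMap_residueField _, ?_, θ (Ideal.Quotient.mk _ X), ?_⟩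
    · rwa [Ne, Ideal.algebraMap_residueField_eq_zero]
    · rw [← hθ, ← Polynomial.hom_eval₂]
      have : F.eval₂ (algebraMap A (A[X] ⧸ Ideal.span {F})) (Ideal.Quotient.mk _ X) =
          Ideal.Quotient.mk _ F := by
        exact (Polynomial.aeval_algHom_apply
          (Ideal.Quotient.mkₐ A (Ideal.span {F})) X F).trans (by rw [aeval_X_left_apply]; rfl)
      rw [this, Ideal.Quotient.eq_zero_iff_mem.mpr (Ideal.mem_span_singleton_self F), map_zero]
  · rintro ⟨k, _, φ, hφ, hh, y, hy⟩
    let ψ : A[X] ⧸ Ideal.span {F} →+* k := Ideal.Quotient.lift _ (eval₂RingHom φ y) (by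
      have : Ideal.span {F} ≤ RingHom.ker (eval₂RingHom φ y) :=
        (Ideal.span_singleton_le_iff_mem _).mpr hy
      exact fun a ha ↦ this ha)
    have hψ : ψ.comp (algebraMap A _) = φ := by
      ext a
      exact eval₂_C φ y
    let z : Spec (.of k) ⟶ Spec (.of (A[X] ⧸ Ideal.span {F})) := Spec.map (CommRingCat.ofHom ψ)
    have hz : z ≫ polyScheme F = Spec.map (CommRingCat.ofHom φ) := by
      rw [polyScheme, ← Spec.map_comp, ← CommRingCat.ofHom_comp, hψ]
    obtain ⟨x, hx, hxφ⟩ := exists_mem_liftPoints_of_isResidueHom _ z φ hz hφ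
    exact ⟨_, ⟨x, hx, rfl⟩, fun hmem ↦ hh (hxφ h hmem)⟩

/-! ### Specializing a point over the fraction field -/

theorem exists_ringHom_extension_of_isIntegral_of_injective {R S Ω : Type*} [CommRing R]
    [CommRing S] [IsDomain S] [Field Ω] [IsAlgClosed Ω] (e : R →+* S) (he : e.IsIntegral)
    (he' : Function.Injective e) (v : R →+* Ω) (hv : Function.Injective v) :
    ∃ χ : S →+* Ω, χ.comp e = v := by
  let := e.toAlgebra
  let := v.toAlgebra
  have : IsDomain R := he'.isDomain e
  have : FaithfulSMul R S := (faithfulSMul_iff_algebraMap_injective _ _).mpr he'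
  have : FaithfulSMul R Ω := (faithfulSMul_iff_algebraMap_injective _ _).mpr hv
  have : Algebra.IsIntegral R S := ⟨he⟩
  let l : S →ₐ[R] Ω := IsAlgClosed.lift
  exact ⟨l.toRingHom, l.comp_algebraMap⟩

/-- Lying over gives a prime of `S` contracting to the kernel of `v`; modulo these primes both maps
are injective. -/
theorem exists_ringHom_extension_of_isIntegral {R S Ω : Type*} [CommRing R] [CommRing S] [Field Ω]
    [IsAlgClosed Ω] (e : R →+* S) (he : e.IsIntegral) (v : R →+* Ω)
    (hv : RingHom.ker e ≤ RingHom.ker v) : ∃ χ : S →+* Ω, χ.comp e = v := by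
  obtain ⟨Q, hQ, hQv⟩ : ∃ Q : Ideal S, Q.IsPrime ∧ Q.comap e = RingHom.ker v := by
    let := e.toAlgebra
    have : Algebra.IsIntegral R S := ⟨he⟩
    have : (RingHom.ker v).IsPrime := RingHom.ker_isPrime v
    obtain ⟨Q, -, hQ⟩ :=
      Ideal.exists_ideal_over_prime_of_isIntegral (S := S) (RingHom.ker v) ⊥ hv
    exact ⟨Q, hQ⟩
  have hint : (Ideal.quotientMap Q e le_rfl).IsIntegral := he.quotient
  obtain ⟨χ, hχ⟩ := exists_ringHom_extension_of_isIntegral_of_injective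
    (Ideal.quotientMap Q e le_rfl) hint Ideal.quotientMap_injective
    (Ideal.Quotient.lift (Q.comap e) v (fun a ha ↦ (hQv.le ha : a ∈ RingHom.ker v)))
    (RingHom.lift_injective_of_ker_le_ideal _ _ hQv.ge)
  refine ⟨χ.comp (Ideal.Quotient.mk Q), ?_⟩
  ext r
  exact congr($hχ (Ideal.Quotient.mk _ r))

/-- When `K` has characteristic zero, `k` may still have positive characteristic; this is harmless,
since the powers `q ^ n` are then all `1`. -/
theorem expChar_eq_one_or_expChar_of_ringHom {O K k : Type*} [CommRing O] [Field K] [Field k]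
    (i : O →+* K) (hi : Function.Injective i) (φ : O →+* k) (q : ℕ) [hq : ExpChar K q] :
    q = 1 ∨ ExpChar k q := by
  rcases hq with _ | ⟨hq⟩
  · exact .inl rfl
  · right
    have := i.charP hi q
    have : CharP k q := (CharP.charP_iff_prime_eq_zero hq).mpr (by
      rw [← map_natCast φ, CharP.cast_eq_zero, map_zero])
    exact .prime hq

theorem mem_perfectClosure_of_pow_mem {k Ω : Type*} [Field k] [Field Ω] [Algebra k Ω] {q : ℕ}
    (hq : q = 1 ∨ ExpChar k q) {x : Ω} {n : ℕ} (hx : x ^ q ^ n ∈ (algebraMap k Ω).range) :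
    x ∈ perfectClosure k Ω := by
  rcases hq with rfl | hq
  · obtain ⟨z, hz⟩ := hx
    rw [one_pow, pow_one] at hz
    exact hz ▸ (perfectClosure k Ω).algebraMap_mem z
  · exact (mem_perfectClosure_iff_pow_mem q).mpr ⟨n, hx⟩

/-- Clearing the denominators of finitely many polynomials. -/
theorem exists_smul_lifts {A K : Type*} [CommRing A] [IsDomain A] [Field K] [Algebra A K]
    [IsFractionRing A K] (s : Finset K[X]) :
    ∃ d : A, d ≠ 0 ∧ ∀ P ∈ s, ∃ P' : A[X], P'.map (algebraMap A K) = d • P := by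
  classical
  induction s using Finset.induction_on with
  | empty => exact ⟨1, one_ne_zero, by simp⟩
  | insert P s _ ih =>
    obtain ⟨d, hd, h⟩ := ih
    obtain ⟨b, hb, hP⟩ := IsLocalization.integerNormalization_spec (nonZeroDivisors A) P
    refine ⟨b * d, mul_ne_zero (nonZeroDivisors.ne_zero hb) hd, fun Q hQ ↦ ?_⟩
    rcases Finset.mem_insert.mp hQ with rfl | hQ
    · refine ⟨d • IsLocalization.integerNormalization (nonZeroDivisors A) Q, ?_⟩
      rw [Polynomial.map_smul, hP, mul_comm b, mul_smul, algebraMap_smul]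
    · obtain ⟨Q', hQ'⟩ := h Q hQ
      exact ⟨b • Q', by rw [Polynomial.map_smul, hQ', mul_smul, algebraMap_smul]⟩

/-- Specialising the integral closure of `O` in an extension `L` of its fraction field along a root
of the minimal polynomial of one of its elements. -/
theorem exists_specialization {O K L k Ω : Type*} [CommRing O] [Field K] [Field L]
    [Field k] [Field Ω] [IsAlgClosed Ω] [Algebra O K] [Algebra K L] [Algebra O L]
    [IsScalarTower O K L] [Algebra k Ω] (hO : Function.Injective (algebraMap O K)) (φ : O →+* k)
    (α : integralClosure O L) (F : O[X]) (hF : F.map (algebraMap O K) = minpoly K (α : L))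
    (hFm : F.Monic) (a : k) (ha : F.eval₂ φ a = 0) :
    ∃ χ : integralClosure O L →+* Ω,
      ∀ P : O[X], χ (aeval α P) = algebraMap k Ω (P.eval₂ φ a) := by
  obtain ⟨χ, hχ⟩ := exists_ringHom_extension_of_isIntegral (aeval α : O[X] →ₐ[O] _).toRingHom
    (fun x ↦ by
      have h : IsIntegral O x := Algebra.IsIntegral.isIntegral x
      have h2 : ((aeval α : O[X] →ₐ[O] integralClosure O L).toRingHom).comp C = algebraMap O _ := by
        ext r; simp
      exact RingHom.IsIntegralElem.of_comp (f := C) (h2 ▸ h))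
    ((algebraMap k Ω).comp (eval₂RingHom φ a)) (fun G hG ↦ by
      have hG' : aeval (α : L) G = 0 := by
        have : aeval α G = 0 := hG
        rw [← Subalgebra.coe_val, aeval_algHom_apply, this, map_zero]
      -- A polynomial vanishing at `α` is divisible by `F`, already over `O` because `F` is monic,
      -- so it vanishes at `a`: evaluation at `a` factors through `O[α]`.
      have h1 : F.map (algebraMap O K) ∣ G.map (algebraMap O K) := by
        rw [hF]
        exact minpoly.dvd _ _ (by rwa [aeval_map_algebraMap])
      obtain ⟨H, rfl⟩ := (Polynomial.map_dvd_map _ hO hFm).mp h1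
      simp [eval₂_mul, ha])
  exact ⟨χ, fun P ↦ congr($hχ P)⟩

/-- A nonzero algebra of finite type with injective structure map has a point in a finite extension
of the fraction field. -/
theorem exists_algHom_finite_fractionRing (A B : Type u) [CommRing A] [IsDomain A] [CommRing B]
    [Algebra A B] [Algebra.FiniteType A B] (hAB : Function.Injective (algebraMap A B)) :
    ∃ (L : Type u) (_ : Field L) (_ : Algebra (FractionRing A) L) (_ : Algebra A L)
      (_ : IsScalarTower A (FractionRing A) L) (_ : FiniteDimensional (FractionRing A) L),
      Nonempty (B →ₐ[A] L) := by
  let K := FractionRing A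
  let T := TensorProduct A K B
  -- Flatness of `K` keeps the structure map injective, so the generic fibre is nonzero; a maximal
  -- ideal of it gives `L`.
  have : Nontrivial T := by
    have h := Module.Flat.lTensor_preserves_injective_linearMap (M := K) (Algebra.linearMap A B) hAB
    have : Nontrivial (TensorProduct A K A) := (TensorProduct.rid A K).symm.injective.nontrivial
    exact h.nontrivial
  obtain ⟨M, hM⟩ := Ideal.exists_maximal T
  let : Field (T ⧸ M) := Ideal.Quotient.field M
  have : Algebra.FiniteType K (T ⧸ M) := inferInstance
  exact ⟨T ⧸ M, inferInstance, inferInstance, inferInstance, inferInstance,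
    finite_of_finite_type_of_isJacobsonRing K (T ⧸ M),
    ⟨(Ideal.Quotient.mkₐ A M).comp Algebra.TensorProduct.includeRight⟩⟩

/-- Up to purely inseparable extensions, a finite field extension is generated by one element. -/
theorem exists_generator_pow_mem (K L : Type*) [Field K] [Field L] [Algebra K L]
    [FiniteDimensional K L] (q : ℕ) [ExpChar K q] :
    ∃ α : L, ∀ c : L, ∃ (n : ℕ) (P : K[X]), aeval α P = c ^ q ^ n := by
  obtain ⟨α, hα⟩ := Field.exists_primitive_element K (separableClosure K L)
  refine ⟨α, fun c ↦ ?_⟩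
  have : ExpChar (separableClosure K L) q :=
    expChar_of_injective_algebraMap (algebraMap K (separableClosure K L)).injective q
  obtain ⟨n, z, hz⟩ := IsPurelyInseparable.pow_mem (separableClosure K L) q c
  have hz' : z ∈ Algebra.adjoin K {α} := by
    rw [← IntermediateField.adjoin_simple_toSubalgebra_of_isAlgebraic
      (Algebra.IsAlgebraic.isAlgebraic α), hα]
    trivial
  rw [Algebra.adjoin_singleton_eq_range_aeval] at hz'
  obtain ⟨P, hP⟩ := hz'
  refine ⟨n, P, ?_⟩
  rw [← hz, ← hP]
  exact aeval_algHom_apply (separableClosure K L).val α P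

theorem exists_lift_of_smul_lift {A K O : Type*} [CommRing A] [Field K] [CommRing O] [Algebra A K]
    [Algebra A O] [Algebra O K] [IsScalarTower A O K] {d : A} (hd : IsUnit (algebraMap A O d))
    {P : K[X]} {P' : A[X]} (h : P'.map (algebraMap A K) = d • P) :
    ∃ Q : O[X], Q.map (algebraMap O K) = P ∧ algebraMap A O d • Q = P'.map (algebraMap A O) := by
  obtain ⟨u, hu⟩ := hd
  refine ⟨(↑u⁻¹ : O) • P'.map (algebraMap A O), ?_, ?_⟩
  · rw [Polynomial.map_smul, map_map, ← IsScalarTower.algebraMap_eq, h,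
      ← algebraMap_smul K d P, IsScalarTower.algebraMap_apply A O K, ← hu, smul_smul, ← map_mul]
    simp
  · rw [← hu, smul_smul]
    simp

/-- Spreading out a point in a finite extension of the fraction field. -/
theorem exists_spread_perfectClosure {A B K L : Type*} [CommRing A] [IsDomain A] [CommRing B]
    [Algebra A B] [Algebra.FiniteType A B] [Field K] [Algebra A K] [IsFractionRing A K] [Field L]
    [Algebra K L] [Algebra A L] [IsScalarTower A K L] [FiniteDimensional K L] (β : B →ₐ[A] L) :
    ∃ (F : A[X]) (d : A), F.natDegree ≠ 0 ∧ d ≠ 0 ∧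
      ∀ (k : Type u) [Field k] (φ : A →+* k) (a : k), φ d ≠ 0 → F.eval₂ φ a = 0 →
        ∃ ψ : B →+* perfectClosure k (AlgebraicClosure k),
          ∀ x, ψ (algebraMap A B x) = algebraMap k _ (φ x) := by
  classical
  obtain ⟨q, hq⟩ := ExpChar.exists K
  obtain ⟨α, hα⟩ := exists_generator_pow_mem K L q
  choose n P hP using hα
  obtain ⟨s, hs⟩ := Algebra.FiniteType.out (R := A) (A := B)
  -- Inverting `d` makes three kinds of polynomials integral: the minimal polynomial of `α`, those
  -- of the images of the generators of `B`, and those expressing `q`-power powers of these images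
  -- through `α`.
  obtain ⟨d, hd, hlift⟩ := exists_smul_lifts (A := A)
    (insert (minpoly K α) (s.image (fun b ↦ minpoly K (β b)) ∪ s.image (fun b ↦ P (β b))))
  obtain ⟨F, hF⟩ := hlift (minpoly K α) (by simp)
  have hAK : Function.Injective (algebraMap A K) := IsFractionRing.injective A K
  refine ⟨F, d, ?_, hd, fun k _ φ a hφd ha ↦ ?_⟩
  · rw [← natDegree_map_eq_of_injective hAK, hF, ← algebraMap_smul K d, natDegree_smul _
      (by simpa using hd)]
    exact (minpoly.natDegree_pos (Algebra.IsIntegral.isIntegral α)).ne'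
  let O := Localization.Away d
  have hdO : IsUnit (algebraMap A O d) := IsLocalization.Away.algebraMap_isUnit d
  have hdK : IsUnit (algebraMap A K d) := IsUnit.mk0 _ (by simpa using hd)
  let : Algebra O K := (IsLocalization.Away.lift d hdK).toAlgebra
  have : IsScalarTower A O K :=
    IsScalarTower.of_algebraMap_eq' (IsLocalization.Away.lift_comp d hdK).symm
  let : Algebra O L := ((algebraMap K L).comp (algebraMap O K)).toAlgebra
  have : IsScalarTower O K L := IsScalarTower.of_algebraMap_eq' rfl
  have : IsScalarTower A O L := IsScalarTower.of_algebraMap_eq' (by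
    rw [IsScalarTower.algebraMap_eq O K L, RingHom.comp_assoc, ← IsScalarTower.algebraMap_eq A O K,
      ← IsScalarTower.algebraMap_eq A K L])
  have hOK : Function.Injective (algebraMap O K) := by
    have : IsFractionRing O K := IsFractionRing.isFractionRing_of_isDomain_of_isLocalization
      (Submonoid.powers d) O K
    exact IsFractionRing.injective O K
  let φ' : O →+* k := IsLocalization.Away.lift d (IsUnit.mk0 _ hφd)
  have hφ' : φ'.comp (algebraMap A O) = φ := IsLocalization.Away.lift_comp d _
  have hint : ∀ c : L, ∀ P' : A[X], P'.map (algebraMap A K) = d • minpoly K c →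
      ∃ Q : O[X], Q.Monic ∧ Q.map (algebraMap O K) = minpoly K c ∧
        algebraMap A O d • Q = P'.map (algebraMap A O) ∧ IsIntegral O c := by
    intro c P' hP'
    obtain ⟨Q, hQ, hQ'⟩ := exists_lift_of_smul_lift hdO hP'
    have hQm : Q.Monic := by
      have := minpoly.monic (Algebra.IsIntegral.isIntegral (R := K) c)
      rw [← hQ] at this
      exact Function.Injective.monic_map_iff hOK |>.mpr this
    refine ⟨Q, hQm, hQ, hQ', Q, hQm, ?_⟩
    rw [← aeval_def, ← aeval_map_algebraMap K, hQ, minpoly.aeval]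
  obtain ⟨Fo, hFm, hFo, hFo', hαint⟩ := hint α F hF
  have hroot : Fo.eval₂ φ' a = 0 := by
    have : (algebraMap A O d • Fo).eval₂ φ' a = 0 := by
      rw [hFo', eval₂_map, hφ', ha]
    rw [eval₂_smul, ← RingHom.comp_apply, hφ'] at this
    exact (mul_eq_zero.mp this).resolve_left hφd
  obtain ⟨χ, hχ⟩ := exists_specialization (Ω := AlgebraicClosure k) hOK φ'
    (⟨α, hαint⟩ : integralClosure O L) Fo hFo hFm a hroot
  have hχA : ∀ x : A, χ (algebraMap O _ (algebraMap A O x)) = algebraMap k _ (φ x) := by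
    intro x
    have := hχ (C (algebraMap A O x))
    rwa [aeval_C, eval₂_C, ← RingHom.comp_apply φ', hφ'] at this
  have hβ : ∀ b : B, β b ∈ integralClosure O L := by
    intro b
    have hb : b ∈ Algebra.adjoin A (s : Set B) := hs ▸ trivial
    induction hb using Algebra.adjoin_induction with
    | mem b hb =>
      obtain ⟨P', hP'⟩ := hlift (minpoly K (β b)) (by
        simp only [Finset.mem_insert, Finset.mem_union, Finset.mem_image]
        exact .inr (.inl ⟨b, hb, rfl⟩))
      obtain ⟨-, -, -, -, h⟩ := hint _ P' hP'
      exact h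
    | algebraMap r =>
      rw [β.commutes, IsScalarTower.algebraMap_apply A O L]
      exact (integralClosure O L).algebraMap_mem _
    | add x y _ _ hx hy => rw [map_add]; exact add_mem hx hy
    | mul x y _ _ hx hy => rw [map_mul]; exact mul_mem hx hy
  let γ : B →+* AlgebraicClosure k :=
    χ.comp (β.toRingHom.codRestrict (integralClosure O L).toSubring hβ)
  have hγA : ∀ x : A, γ (algebraMap A B x) = algebraMap k _ (φ x) := by
    intro x
    rw [← hχA]
    refine congrArg χ (Subtype.ext ?_)
    exact (β.commutes x).trans (IsScalarTower.algebraMap_apply A O L x)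
  have hγ : ∀ b : B, γ b ∈ perfectClosure k (AlgebraicClosure k) := by
    intro b
    have hb : b ∈ Algebra.adjoin A (s : Set B) := hs ▸ trivial
    induction hb using Algebra.adjoin_induction with
    | mem b hb =>
      obtain ⟨P', hP'⟩ := hlift (P (β b)) (by
        simp only [Finset.mem_insert, Finset.mem_union, Finset.mem_image]
        exact .inr (.inr ⟨b, hb, rfl⟩))
      obtain ⟨Q, hQ, -⟩ := exists_lift_of_smul_lift hdO hP'
      -- The relation `β b ^ q ^ n = Q(α)` specializes to `γ b ^ q ^ n = Q(a)`, an element of `k`.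
      refine mem_perfectClosure_of_pow_mem
        (expChar_eq_one_or_expChar_of_ringHom _ hAK φ q) (n := n (β b)) ⟨Q.eval₂ φ' a, ?_⟩
      rw [← map_pow]
      refine (hχ Q).symm.trans ?_
      refine congrArg χ (Subtype.ext ?_)
      refine (aeval_algHom_apply (integralClosure O L).val _ Q).symm.trans ?_
      change aeval α Q = (β (b ^ _))
      rw [map_pow, ← hP, ← hQ, aeval_map_algebraMap]
    | algebraMap r =>
      rw [hγA]
      exact (perfectClosure k (AlgebraicClosure k)).algebraMap_mem _
    | add x y _ _ hx hy => rw [map_add]; exact add_mem hx hy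
    | mul x y _ _ hx hy => rw [map_mul]; exact mul_mem hx hy
  exact ⟨γ.codRestrict (perfectClosure k (AlgebraicClosure k)).toSubring hγ,
    fun x ↦ Subtype.ext (hγA x)⟩

theorem exists_purelyInseparable_point {A B : Type u} [CommRing A] [IsDomain A] [CommRing B]
    [Algebra A B] [Algebra.FiniteType A B] (hAB : Function.Injective (algebraMap A B))
    (hA : ∀ F : A[X], F.natDegree ≠ 0 → ∀ h : A, h ≠ 0 → HasResidualRoot F h) :
    ∃ (E : Type u) (_ : Field E) (ψ : B →+* E) (q : ℕ) (_ : ExpChar E q), ∀ z : E,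
      ∃ (n : ℕ) (a b : A), ψ (algebraMap A B b) ≠ 0 ∧
        z ^ q ^ n * ψ (algebraMap A B b) = ψ (algebraMap A B a) := by
  obtain ⟨L, _, _, _, _, _, ⟨β⟩⟩ := exists_algHom_finite_fractionRing A B hAB
  obtain ⟨F, d, hF, hd, h⟩ := exists_spread_perfectClosure (K := FractionRing A) β
  obtain ⟨k, _, φ, hφ, hφd, a, ha⟩ := hA F hF d hd
  obtain ⟨ψ, hψ⟩ := h k φ a hφd ha
  obtain ⟨q, hq⟩ := ExpChar.exists k
  have : ExpChar (perfectClosure k (AlgebraicClosure k)) q :=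
    expChar_of_injective_algebraMap (algebraMap k _).injective q
  refine ⟨_, inferInstance, ψ, q, this, fun z ↦ ?_⟩
  obtain ⟨n, w, hw⟩ := IsPurelyInseparable.pow_mem k q z
  obtain ⟨a, b, hb, hab⟩ := hφ w
  refine ⟨n, a, b, ?_, ?_⟩
  · rw [hψ]
    exact (_root_.map_ne_zero _).mpr hb
  · rw [hψ, hψ, ← hw, ← map_mul, hab]

/-! ### Localization at one element -/

theorem hasResidualRoot_map_iff {A S : Type u} [CommRing A] [CommRing S] [Algebra A S] (g : A)
    [IsLocalization.Away g S] (F : A[X]) (h : A) :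
    HasResidualRoot (F.map (algebraMap A S)) (algebraMap A S h) ↔ HasResidualRoot F (g * h) := by
  constructor
  · rintro ⟨k, _, φ, hφ, hh, y, hy⟩
    refine ⟨k, inferInstance, φ.comp (algebraMap A S), fun z ↦ ?_, ?_, y, ?_⟩
    · obtain ⟨a, b, hb, hab⟩ := hφ z
      obtain ⟨⟨a', b', s⟩, ha, hb'⟩ : ∃ x : A × A × Submonoid.powers g,
          a * algebraMap A S x.2.2 = algebraMap A S x.1 ∧
            b * algebraMap A S x.2.2 = algebraMap A S x.2.1 := by
        obtain ⟨⟨a', s⟩, ha⟩ := IsLocalization.surj (Submonoid.powers g) a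
        obtain ⟨⟨b', t⟩, hb⟩ := IsLocalization.surj (Submonoid.powers g) b
        refine ⟨⟨a' * t, b' * s, s * t⟩, ?_, ?_⟩
        · simp only [Submonoid.coe_mul, map_mul] at ha ⊢
          rw [← ha]; ring
        · simp only [Submonoid.coe_mul, map_mul] at hb ⊢
          rw [← hb]; ring
      have hs : φ (algebraMap A S s) ≠ 0 :=
        ((IsLocalization.map_units S s).map φ).ne_zero
      refine ⟨a', b', ?_, ?_⟩
      · rw [RingHom.comp_apply, ← hb', map_mul]
        exact mul_ne_zero hb hs
      · rw [RingHom.comp_apply, RingHom.comp_apply, ← hb', ← ha, map_mul, map_mul, ← mul_assoc, hab]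
    · rw [map_mul]
      exact mul_ne_zero ((IsLocalization.Away.algebraMap_isUnit g).map φ).ne_zero hh
    · rwa [eval₂_map] at hy
  · rintro ⟨k, _, φ, hφ, hh, y, hy⟩
    rw [map_mul] at hh
    have hg : IsUnit (φ g) := IsUnit.mk0 _ (left_ne_zero_of_mul hh)
    let φ' : S →+* k := IsLocalization.Away.lift g hg
    have hφ' : ∀ a, φ' (algebraMap A S a) = φ a := IsLocalization.Away.lift_eq g hg
    refine ⟨k, inferInstance, φ', fun z ↦ ?_, ?_, y, ?_⟩
    · obtain ⟨a, b, hb, hab⟩ := hφ z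
      exact ⟨algebraMap A S a, algebraMap A S b, by rwa [hφ'], by rwa [hφ', hφ']⟩
    · rw [hφ']
      exact right_ne_zero_of_mul hh
    · rwa [eval₂_map, IsLocalization.Away.lift_comp]

theorem HasResidualRoot.of_mul {A : Type u} [CommRing A] {F G : A[X]} {h h' : A}
    (H : HasResidualRoot F (h * h')) (hFG : ∀ (k : Type u) [Field k] (φ : A →+* k), φ h' ≠ 0 →
      ∀ y, F.eval₂ φ y = 0 → G.eval₂ φ y = 0) : HasResidualRoot G h := by
  obtain ⟨k, _, φ, hφ, hh, y, hy⟩ := H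
  rw [map_mul] at hh
  exact ⟨k, _, φ, hφ, left_ne_zero_of_mul hh, y, hFG k φ (right_ne_zero_of_mul hh) y hy⟩

theorem satisfiesP1_iff_of_isLocalization_away {A S : Type u} [CommRing A] [IsDomain A]
    [CommRing S] [IsDomain S] [Algebra A S] {g : A} (hg : g ≠ 0) [IsLocalization.Away g S] :
    SatisfiesP1 A ↔ SatisfiesP1 S := by
  have hM : Submonoid.powers g ≤ nonZeroDivisors A := powers_le_nonZeroDivisors_of_noZeroDivisors hg
  have hinj : Function.Injective (algebraMap A S) := IsLocalization.injective S hM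
  rw [satisfiesP1_iff, satisfiesP1_iff]
  constructor
  · intro H F hF h hh
    obtain ⟨b, hb, hF'⟩ := IsLocalization.integerNormalization_spec (Submonoid.powers g) F
    set F' := IsLocalization.integerNormalization (Submonoid.powers g) F
    obtain ⟨⟨h', s⟩, hs⟩ := IsLocalization.surj (Submonoid.powers g) h
    have hb0 : algebraMap A S b ≠ 0 := (IsLocalization.map_units S ⟨b, hb⟩).ne_zero
    have hs0 : algebraMap A S s ≠ 0 := (IsLocalization.map_units S s).ne_zero
    rw [← algebraMap_smul S] at hF'
    have key : HasResidualRoot (F'.map (algebraMap A S)) (algebraMap A S h') := by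
      refine (hasResidualRoot_map_iff g F' h').mpr (H F' ?_ _ (mul_ne_zero hg ?_))
      · rwa [← natDegree_map_eq_of_injective hinj, hF', natDegree_smul _ hb0]
      · rintro rfl
        rw [map_zero] at hs
        exact mul_ne_zero hh hs0 hs
    dsimp only at hs
    rw [← hs] at key
    refine key.of_mul fun k _ φ _ y hy ↦ ?_
    rw [hF', eval₂_smul] at hy
    exact (mul_eq_zero.mp hy).resolve_left
      ((IsLocalization.map_units S ⟨b, hb⟩).map φ).ne_zero
  · intro H F hF h hh
    have := (hasResidualRoot_map_iff g F h).mp (H (F.map (algebraMap A S))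
      (by rwa [natDegree_map_eq_of_injective hinj]) _ ((map_ne_zero_iff _ hinj).mpr hh))
    rw [mul_comm] at this
    exact this.of_mul fun k _ φ _ y hy ↦ hy

theorem SatisfiesP2.of_isLocalization_away {A S : Type*} [CommRing A] [IsDomain A]
    [CommRing S] [IsDomain S] [Algebra A S] {g : A} (hg : g ≠ 0) [IsLocalization.Away g S]
    (H : SatisfiesP2 A) : SatisfiesP2 S := by
  have hM : Submonoid.powers g ≤ nonZeroDivisors A := powers_le_nonZeroDivisors_of_noZeroDivisors hg
  have hinj : Function.Injective (algebraMap A S) := IsLocalization.injective S hM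
  intro F₁ hF₁
  obtain ⟨b, hb, hF⟩ := IsLocalization.integerNormalization_spec (Submonoid.powers g) F₁
  set F := IsLocalization.integerNormalization (Submonoid.powers g) F₁
  have hb0 : algebraMap A S b ≠ 0 := (IsLocalization.map_units S ⟨b, hb⟩).ne_zero
  rw [← algebraMap_smul S] at hF
  have hF0 : F.natDegree ≠ 0 := by
    rwa [← natDegree_map_eq_of_injective hinj, hF, natDegree_smul _ hb0]
  suffices ∃ x : A, ¬ IsUnit (algebraMap A S (F.eval x)) by
    obtain ⟨x, hx⟩ := this
    refine ⟨algebraMap A S x, fun hu ↦ hx ?_⟩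
    rw [← eval_map_apply, hF, eval_smul]
    exact (IsLocalization.map_units S ⟨b, hb⟩).mul hu
  -- If the constant term vanishes, the value at `0` is a nonunit and division by `F(0)` is not
  -- needed.
  by_cases h0 : F.coeff 0 = 0
  · refine ⟨0, ?_⟩
    rw [← coeff_zero_eq_eval_zero, h0, map_zero]
    exact not_isUnit_zero
  let c := F.coeff 0 * g
  have hc : c ≠ 0 := mul_ne_zero h0 hg
  let G : A[X] := C g * (X * F.divX.comp (C c * X)) + 1
  have hG : F.comp (C c * X) = C (F.coeff 0) * G := by
    conv_lhs => rw [← divX_mul_X_add F]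
    simp only [add_comp, mul_comp, X_comp, C_comp, G, c, C_mul]
    ring
  have hGdeg : G.natDegree ≠ 0 := by
    have : (F.comp (C c * X)).natDegree ≠ 0 := by
      rw [natDegree_comp, natDegree_C_mul_X _ hc, mul_one]
      exact hF0
    rwa [hG, natDegree_C_mul h0] at this
  obtain ⟨x, hx⟩ := H G hGdeg
  refine ⟨c * x, fun hu ↦ ?_⟩
  have hev : F.eval (c * x) = F.coeff 0 * G.eval x := by
    have := congrArg (eval x) hG
    simpa [eval_comp] using this
  rw [hev, map_mul] at hu
  obtain ⟨m, hm, hmem⟩ := exists_max_ideal_of_mem_nonunits hx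
  -- Since `G` is `1` modulo `g`, an ideal containing both `g` and a value of `G` is the unit ideal.
  -- Hence `m` stays proper in `S`.
  have hgm : g ∉ m := fun hgm ↦ by
    refine hm.ne_top ((Ideal.eq_top_iff_one m).mpr ?_)
    have : (1 : A) = G.eval x - g * (x * (F.divX.comp (C c * X)).eval x) := by
      simp [G]
    rw [this]
    exact m.sub_mem hmem (m.mul_mem_right _ hgm)
  have hdisj : Disjoint (Submonoid.powers g : Set A) (m : Set A) := by
    rw [Set.disjoint_left]
    rintro _ ⟨n, rfl⟩ hn
    exact hgm (hm.isPrime.mem_of_pow_mem n hn)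
  have hprime := IsLocalization.isPrime_of_isPrime_disjoint (Submonoid.powers g) S m hm.isPrime hdisj
  exact hprime.ne_top (Ideal.eq_top_of_isUnit_mem _ (Ideal.mem_map_of_mem _ hmem)
    (isUnit_of_mul_isUnit_right hu))

/-! ### Comparison of (P1) and (P2) -/

theorem SatisfiesP2.satisfiesP1 {A : Type u} [CommRing A] [IsDomain A] (H : SatisfiesP2 A) :
    SatisfiesP1 A := by
  rw [satisfiesP1_iff]
  intro F hF h hh
  let S := Localization.Away h
  have hM : Submonoid.powers h ≤ nonZeroDivisors A := powers_le_nonZeroDivisors_of_noZeroDivisors hh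
  have : IsDomain S := IsLocalization.isDomain_localization hM
  have hinj : Function.Injective (algebraMap A S) := IsLocalization.injective S hM
  obtain ⟨b, hb⟩ := H.of_isLocalization_away (S := S) hh (F.map (algebraMap A S))
    (by rwa [natDegree_map_eq_of_injective hinj])
  obtain ⟨m, hm, hmem⟩ := exists_max_ideal_of_mem_nonunits hb
  -- In `A_h` the element `h` is a unit, so the trivial condition `1 ≠ 0` there becomes `h ≠ 0` on
  -- `A`.
  have key : HasResidualRoot (F.map (algebraMap A S)) (algebraMap A S 1) := by
    refine ⟨m.ResidueField, inferInstance, algebraMap S _, isResidueHom_algebraMap_residueField m,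
      by simp, algebraMap S _ b, ?_⟩
    rw [eval₂_at_apply, Ideal.algebraMap_residueField_eq_zero]
    exact hmem
  simpa using (hasResidualRoot_map_iff h F 1).mp key

theorem SatisfiesP1.satisfiesP2 {A : Type u} [CommRing A] [IsDomain A] [IsJacobsonRing A]
    (H : SatisfiesP1 A) : SatisfiesP2 A := by
  rw [satisfiesP1_iff] at H
  intro F hF
  obtain ⟨k, _, φ, hφ, -, y, hy⟩ := H F hF 1 one_ne_zero
  obtain ⟨a, b, hb, hab⟩ := hφ y
  have hP : (RingHom.ker φ).IsPrime := RingHom.ker_isPrime φ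
  have hjac : (RingHom.ker φ).jacobson = RingHom.ker φ := IsJacobsonRing.out' _ hP.isRadical
  -- The Jacobson property: the prime `ker φ` is an intersection of maximal ideals, and `b` is not
  -- in it.
  obtain ⟨m, hm, hkm, hbm⟩ : ∃ m : Ideal A, m.IsMaximal ∧ RingHom.ker φ ≤ m ∧ b ∉ m := by
    by_contra! hcon
    refine hb ?_
    rw [← RingHom.mem_ker, ← hjac, Ideal.jacobson, Ideal.mem_sInf]
    exact fun {I} hI ↦ hcon I hI.2 hI.1
  -- `scaleRoots` multiplies the root `a / b` by `b`, so that vanishing can be stated in `A` and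
  -- reduced modulo `m`. There `b` has an inverse `c`, and `a * c` represents the root.
  have hmem : (F.scaleRoots b).eval a ∈ m := by
    apply hkm
    rw [RingHom.mem_ker, ← eval₂_at_apply, ← hab, mul_comm, scaleRoots_eval₂_mul, hy, mul_zero]
  let π := Ideal.Quotient.mk m
  obtain ⟨c, hc⟩ := hm.exists_inv hbm
  obtain ⟨i, hi, hci⟩ := hc
  have hbc : π b * π (a * c) = π a := by
    have h1 : π (c * b) = 1 := by
      rw [← map_one π, ← hci, map_add, Ideal.Quotient.eq_zero_iff_mem.mpr hi, add_zero]
    rw [← map_mul, show b * (a * c) = a * (c * b) by ring, map_mul, h1, mul_one]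
  refine ⟨a * c, fun hu ↦ hm.ne_top (Ideal.eq_top_of_isUnit_mem _ ?_ hu)⟩
  have h2 : (F.scaleRoots b).eval₂ π (π b * π (a * c)) = 0 := by
    rw [hbc, eval₂_at_apply]
    exact Ideal.Quotient.eq_zero_iff_mem.mpr hmem
  rw [scaleRoots_eval₂_mul, eval₂_at_apply, ← map_pow, ← map_mul,
    Ideal.Quotient.eq_zero_iff_mem] at h2
  exact (hm.isPrime.mem_or_mem h2).resolve_left fun h ↦ hbm (hm.isPrime.mem_of_pow_mem _ h)

/-! ### Dominant morphisms and the Poonen property -/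

/-- A quasi-compact dominant morphism to a nonempty open subscheme of the spectrum of a domain is
dominant, hence injective on rings of functions, on some affine open. -/
theorem exists_affineOpen_injective {A : Type u} [CommRing A] [IsDomain A]
    {U : (Spec (.of A)).Opens} (hU : (U : Set (Spec (.of A))).Nonempty) {X : Scheme.{u}}
    (f : X ⟶ U.toScheme) [QuasiCompact f] [IsDominant f] :
    ∃ (V : X.affineOpens) (φ : CommRingCat.of A ⟶ Γ(X, V)),
      V.2.fromSpec ≫ f ≫ U.ι = Spec.map φ ∧ Function.Injective φ.hom := by
  obtain ⟨p, hp⟩ := hU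
  obtain ⟨_, ⟨h, rfl⟩, hph, hhU⟩ :=
    (PrimeSpectrum.isTopologicalBasis_basic_opens (R := A)).exists_subset_of_mem_open hp U.isOpen
  have hh : h ≠ 0 := by rintro rfl; simp at hph; exact hph
  let D : A → Set U := fun a ↦ U.ι ⁻¹' (PrimeSpectrum.basicOpen a : Set (PrimeSpectrum A))
  have hDopen : ∀ a, IsOpen (D a) := fun a ↦
    (PrimeSpectrum.basicOpen a).isOpen.preimage U.ι.continuous
  have hDcomp : IsCompact (D h) := by
    refine (U.ι.isOpenEmbedding.isInducing.isCompact_preimage_iff ?_).mpr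
      (PrimeSpectrum.isCompact_basicOpen h)
    rw [Scheme.Opens.range_ι]
    exact hhU
  obtain ⟨s, hs, hcover⟩ := isCompact_and_isOpen_iff_finite_and_eq_biUnion_affineOpens.mp
    ⟨QuasiCompact.isCompact_preimage (f := f) _ (hDopen h) hDcomp,
      (hDopen h).preimage f.continuous⟩
  let φ : ∀ V : X.affineOpens, CommRingCat.of A ⟶ Γ(X, V) := fun V ↦
    Spec.preimage (V.2.fromSpec ≫ f ≫ U.ι)
  have hφ : ∀ V, V.2.fromSpec ≫ f ≫ U.ι = Spec.map (φ V) := fun V ↦ (Spec.map_preimage _).symm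
  by_contra! hcon
  have hker : ∀ V : X.affineOpens, ∃ a : A, a ≠ 0 ∧ (φ V).hom a = 0 := by
    intro V
    have := hcon V (φ V) (hφ V)
    rw [injective_iff_map_eq_zero] at this
    push Not at this
    obtain ⟨a, ha, ha0⟩ := this
    exact ⟨a, ha0, ha⟩
  choose a ha0 ha using hker
  -- Finitely many affine opens cover the preimage of `D(h)`, and each kills its `a V`. By density
  -- some `f x` lies in `D(b)`; but `x` lies in one of these opens, where `a V` vanishes.
  let b := h * ∏ V ∈ hs.toFinset, a V
  have hb : b ≠ 0 := mul_ne_zero hh (Finset.prod_ne_zero_iff.mpr fun V _ ↦ ha0 V)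
  have hne : (D b).Nonempty := by
    let η : PrimeSpectrum A := ⊥
    have hη : ∀ {a : A}, a ≠ 0 → a ∉ η.asIdeal := fun ha ↦ by simpa [η] using ha
    exact ⟨⟨η, hhU (hη hh)⟩, hη hb⟩
  obtain ⟨x, hx⟩ := f.denseRange.exists_mem_open (hDopen b) hne
  have hmul : ∀ {a : A}, a ∣ b → f x ∈ D a := fun {a} ⟨c, hc⟩ ha ↦ hx (by
    rw [hc]
    exact Ideal.mul_mem_right _ _ ha)
  have hxh : x ∈ f ⁻¹' D h := hmul (dvd_mul_right _ _)
  rw [hcover] at hxh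
  simp only [Set.mem_iUnion] at hxh
  obtain ⟨V, hV, hxV⟩ := hxh
  have haV : f x ∈ D (a V) :=
    hmul ((Finset.dvd_prod_of_mem a (hs.mem_toFinset.mpr hV)).mul_left h)
  obtain ⟨z, rfl⟩ : x ∈ Set.range V.2.fromSpec := by
    rw [V.2.range_fromSpec]
    exact hxV
  refine haV (?_ : a V ∈ PrimeSpectrum.asIdeal ((V.2.fromSpec ≫ f ≫ U.ι) z))
  rw [hφ V]
  change (φ V).hom (a V) ∈ PrimeSpectrum.asIdeal z
  rw [ha]
  exact Ideal.zero_mem _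

theorem SatisfiesP1.isPoonenRing {A : Type u} [CommRing A] [IsDomain A] (H : SatisfiesP1 A) :
    IsPoonenRing A := by
  rw [satisfiesP1_iff] at H
  intro U hU X f ⟨_, _, _⟩ _
  obtain ⟨V, φ, hφ, hinj⟩ := exists_affineOpen_injective hU f
  have hft : φ.hom.FiniteType := by
    have : LocallyOfFiniteType (Spec.map φ) := by
      rw [← hφ]
      have : IsOpenImmersion V.2.fromSpec := IsAffineOpen.isOpenImmersion_fromSpec V.2
      have : LocallyOfFiniteType f := inferInstance
      have : LocallyOfFiniteType (f ≫ U.ι) := inferInstance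
      exact MorphismProperty.comp_mem @LocallyOfFiniteType _ _ inferInstance this
    exact (HasRingHomProperty.Spec_iff (P := @LocallyOfFiniteType)).mp this
  let : Algebra A Γ(X, V) := φ.hom.toAlgebra
  have : Algebra.FiniteType A Γ(X, V) := hft
  obtain ⟨E, _, ψ, q, _, hψ⟩ := exists_purelyInseparable_point (B := Γ(X, V)) hinj H
  -- The point is found over `Spec A` and then viewed over `U`: pure inseparability passes to the
  -- upper step of a tower.
  obtain ⟨x, hx⟩ := quasiLiftPoints_nonempty_of_pow_mem (f ≫ U.ι)
    (Spec.map (CommRingCat.ofHom ψ) ≫ V.2.fromSpec) (ψ.comp φ.hom)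
    (by rw [Category.assoc, hφ, ← Spec.map_comp]; rfl) q hψ
  exact ⟨f x, x, quasiLiftPoints_comp_subset f U.ι hx, rfl⟩

theorem satisfiesP2_iff_satisfiesP1 (A : Type u) [CommRing A] [IsDomain A] [IsJacobsonRing A] :
    SatisfiesP2 A ↔ SatisfiesP1 A :=
  ⟨SatisfiesP2.satisfiesP1, SatisfiesP1.satisfiesP2⟩

theorem proposition4p1p8 (A : Type u) [CommRing A] [IsDomain A] (g : A) (hg : g ≠ 0) :
    ((SatisfiesP2 A → SatisfiesP1 A) ∧
      (SatisfiesP2 (Localization.Away g) → SatisfiesP1 (Localization.Away g)) ∧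
      (SatisfiesP1 A → IsPoonenRing A) ∧
      (SatisfiesP2 A → SatisfiesP2 (Localization.Away g)) ∧
      (SatisfiesP1 A ↔ SatisfiesP1 (Localization.Away g))) ∧
    (IsJacobsonRing A →
      (SatisfiesP2 A ↔ SatisfiesP1 A) ∧
      (SatisfiesP2 (Localization.Away g) ↔ SatisfiesP1 (Localization.Away g)) ∧
      (SatisfiesP2 A ↔ SatisfiesP2 (Localization.Away g))) := by
  have : IsDomain (Localization.Away g) :=
    IsLocalization.isDomain_localization (powers_le_nonZeroDivisors_of_noZeroDivisors hg)
  have h1 : SatisfiesP1 A ↔ SatisfiesP1 (Localization.Away g) :=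
    satisfiesP1_iff_of_isLocalization_away hg
  refine ⟨⟨SatisfiesP2.satisfiesP1, SatisfiesP2.satisfiesP1, SatisfiesP1.isPoonenRing,
    SatisfiesP2.of_isLocalization_away hg, h1⟩, fun _ ↦ ?_⟩
  have : IsJacobsonRing (Localization.Away g) := isJacobsonRing_localization g
  have h2 := satisfiesP2_iff_satisfiesP1 A
  have h3 := satisfiesP2_iff_satisfiesP1 (Localization.Away g)
  exact ⟨h2, h3, h2.trans (h1.trans h3.symm)⟩
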